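/- For $n\in\mathbb N$ and $1\le p<\infty$ put $\|x\|_p=\big(\sum_{i=1}^n|x_i|^p\big)^{1/p}$ for $x\in\mathbb R^n$, $\mathbb B_p^n=\{x\in\mathbb R^n:\|x\|_p\le 1\}$ and $\mathbb S_p^{n-1}=\{x\in\mathbb R^n:\|x\|_p=1\}$. The cone probability measure of $\mathbb B_p^n$ is the measure on the Borel subsets $B$ of $\mathbb S_p^{n-1}$ given by $$\mathbf m_{\mathbb B_p^n}(B)=\frac{\mathrm{vol}_n(\{rx:x\in B,\ 0\le r\le 1\})}{\mathrm{vol}_n(\mathbb B_p^n)}.$$ Let $\psi_2(x)=e^{x^2}-1$. For a probability space $(\Omega,\mathcal F,\mathbf P)$, the Orlicz space $L_{\psi_2}(\Omega,\mathbf P)$ consists of all measurable $f:\Omega\to\mathbb R$ (modulo almost everywhere equality) with $\int_\Omega\psi_2(|f|/\lambda)\,d\mathbf P<\infty$ for some $\lambda>0$, and it carries the Luxemburg norm $$\|f\|_{\psi_2}=\inf\Big\{\lambda>0:\int_\Omega\psi_2\Big(\frac{|f|}{\lambda}\Big)\,d\mathbf P\le 1\Big\}.$$ Proposition. There exists an absolute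 constant $c_{\psi_2}\in(0,\infty)$ such that for all real $p$ with $2\le p<\infty$, all $n\in\mathbb N$ and all $\theta\in\mathbb R^n$ with $\|\theta\|_2=1$, the function $x\mapsto n^{1/p}\langle x,\theta\rangle$ on $\mathbb S_p^{n-1}$ belongs to $L_{\psi_2}(\mathbb S_p^{n-1},\mathbf m_{\mathbb B_p^n})$ and $$\big\|n^{1/p}\langle\,\cdot\,,\theta\rangle\big\|_{\psi_2}\le c_{\psi_2},$$ where $\|\cdot\|_{\psi_2}$ is the norm of $L_{\psi_2}(\mathbb S_p^{n-1},\mathbf m_{\mathbb B_p^n})$ and $\langle\cdot,\cdot\rangle$ is the standard scalar product. -/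

import Mathlib

open MeasureTheory Set
open scoped ENNReal

/-- The `ℓ_p` norm `‖x‖_p = (∑ i, |x i| ^ p) ^ (1 / p)` on `ℝⁿ`. -/
noncomputable def ellpNorm {n : ℕ} (p : ℝ) (x : EuclideanSpace ℝ (Fin n)) : ℝ :=
  (∑ i, |x i| ^ p) ^ (1 / p)

/-- The unit ball `B_p^n` of `ℓ_p^n`. -/
def lpBall (n : ℕ) (p : ℝ) : Set (EuclideanSpace ℝ (Fin n)) := {x | ellpNorm p x ≤ 1}

/-- The unit sphere `S_p^{n-1}` of `ℓ_p^n`; as a type it carries the Borel σ-algebra. -/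
def lpSphere (n : ℕ) (p : ℝ) : Set (EuclideanSpace ℝ (Fin n)) := {x | ellpNorm p x = 1}

/-- The cone `{r x : x ∈ B, 0 ≤ r ≤ 1}` over `B` with apex at the origin. -/
def coneOver {n : ℕ} (B : Set (EuclideanSpace ℝ (Fin n))) : Set (EuclideanSpace ℝ (Fin n)) :=
  {y | ∃ x ∈ B, ∃ r : ℝ, 0 ≤ r ∧ r ≤ 1 ∧ y = r • x}

theorem ellpNorm_smul {n : ℕ} {p : ℝ} (hp : 1 ≤ p) {r : ℝ} (hr : 0 ≤ r)
    (x : EuclideanSpace ℝ (Fin n)) : ellpNorm p (r • x) = r * ellpNorm p x := by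
  have hp0 : p ≠ 0 := by linarith
  have hs : 0 ≤ ∑ i, |x i| ^ p := Finset.sum_nonneg fun i _ => by positivity
  simp only [ellpNorm, PiLp.smul_apply, smul_eq_mul, abs_mul, abs_of_nonneg hr,
    Real.mul_rpow hr (abs_nonneg _), ← Finset.mul_sum]
  rw [Real.mul_rpow (by positivity) hs, ← Real.rpow_mul hr, mul_one_div_cancel hp0, Real.rpow_one]

theorem measurable_ellpNorm (n : ℕ) (p : ℝ) :
    Measurable (ellpNorm p : EuclideanSpace ℝ (Fin n) → ℝ) := by
  unfold ellpNorm
  fun_prop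

theorem measurableSet_lpSphere (n : ℕ) (p : ℝ) : MeasurableSet (lpSphere n p) :=
  measurable_ellpNorm n p (measurableSet_singleton 1)

/-- The cone over `B` without its apex, in polar form. -/
def puncturedCone {n : ℕ} {p : ℝ} (B : Set (lpSphere n p)) : Set (EuclideanSpace ℝ (Fin n)) :=
  {y | ellpNorm p y ≤ 1 ∧ (ellpNorm p y)⁻¹ • y ∈ ((↑) '' B : Set (EuclideanSpace ℝ (Fin n)))}

theorem measurableSet_puncturedCone {n : ℕ} {p : ℝ} {B : Set (lpSphere n p)}
    (hB : MeasurableSet B) : MeasurableSet (puncturedCone B) := by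
  have h := measurable_ellpNorm n p
  exact (measurableSet_le h measurable_const).inter
    ((h.inv.smul measurable_id) ((measurableSet_lpSphere n p).subtype_image hB))

theorem zero_notMem_lpSphere {n : ℕ} {p : ℝ} (hp : 1 ≤ p) : 0 ∉ lpSphere n p := by
  have h := ellpNorm_smul hp le_rfl (0 : EuclideanSpace ℝ (Fin n))
  simp only [zero_smul, zero_mul] at h
  simp [lpSphere, h]

theorem volume_coneOver {n : ℕ} {p : ℝ} (hp : 1 ≤ p) (B : Set (lpSphere n p)) :
    volume (coneOver ((↑) '' B : Set (EuclideanSpace ℝ (Fin n)))) = volume (puncturedCone B) := by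
  rcases B.eq_empty_or_nonempty with rfl | ⟨b, -⟩
  · simp [coneOver, puncturedCone]
  have : Nontrivial (EuclideanSpace ℝ (Fin n)) :=
    ⟨b, 0, fun h => zero_notMem_lpSphere hp (h ▸ b.2)⟩
  have h0 : volume ({0} : Set (EuclideanSpace ℝ (Fin n))) = 0 := measure_singleton 0
  apply le_antisymm
  · have hsub : coneOver ((↑) '' B : Set (EuclideanSpace ℝ (Fin n))) ⊆
        puncturedCone B ∪ {0} := by
      rintro _ ⟨x, hx, r, hr0, hr1, rfl⟩
      rcases hr0.eq_or_lt with rfl | hr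
      · simp
      left
      have hx1 : ellpNorm p x = 1 := by
        obtain ⟨y, -, rfl⟩ := hx
        exact y.2
      have h1 : ellpNorm p (r • x) = r := by rw [ellpNorm_smul hp hr0, hx1, mul_one]
      refine ⟨by rw [h1]; exact hr1, ?_⟩
      rw [h1, smul_smul, inv_mul_cancel₀ hr.ne', one_smul]
      exact hx
    calc _ ≤ volume (puncturedCone B ∪ {0}) := measure_mono hsub
      _ ≤ volume (puncturedCone B) + volume {0} := measure_union_le _ _
      _ = _ := by rw [h0, add_zero]
  · refine measure_mono fun y hy => ?_
    obtain ⟨hy1, hy2⟩ := hy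
    have hne : ellpNorm p y ≠ 0 := by
      intro h
      rw [h, inv_zero, zero_smul] at hy2
      obtain ⟨z, -, hz⟩ := hy2
      exact zero_notMem_lpSphere hp (hz ▸ z.2)
    refine ⟨_, hy2, ellpNorm p y, ?_, hy1, ?_⟩
    · exact Real.rpow_nonneg (Finset.sum_nonneg fun i _ => by positivity) _
    · rw [smul_smul, mul_inv_cancel₀ hne, one_smul]

/-- The cone probability measure of `B_p^n` on the Borel subsets of `S_p^{n-1}`:
`B ↦ vol {r x : x ∈ B, 0 ≤ r ≤ 1} / vol B_p^n`. -/
noncomputable def coneMeasure (n : ℕ) (p : ℝ) (hp : 1 ≤ p) : Measure (lpSphere n p) :=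
  Measure.ofMeasurable
    (fun B _ => volume (coneOver ((↑) '' B : Set (EuclideanSpace ℝ (Fin n)))) /
      volume (lpBall n p))
    (by simp [coneOver])
    (by
      intro f hf hd
      have hunion : puncturedCone (⋃ i, f i) = ⋃ i, puncturedCone (f i) := by
        ext y
        simp only [puncturedCone, image_iUnion, mem_iUnion, mem_ofPred_eq, exists_and_left]
      have hdisj : Pairwise (Function.onFun Disjoint fun i => puncturedCone (f i)) := by
        intro i j hij
        refine Set.disjoint_left.2 fun y hi hj => ?_
        obtain ⟨a, ha, hay⟩ := hi.2
        obtain ⟨b, hb, hby⟩ := hj.2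
        have hab : a = b := Subtype.ext (hay.trans hby.symm)
        exact Set.disjoint_left.1 (hd hij) ha (hab ▸ hb)
      simp only [volume_coneOver hp]
      rw [hunion, measure_iUnion hdisj fun i => measurableSet_puncturedCone (hf i)]
      simp only [div_eq_mul_inv, ENNReal.tsum_mul_right])

/-- Membership of `f` in the Orlicz space `L_M(Ω, P)` of an Orlicz function `M`. -/
def MemOrlicz {Ω : Type*} [MeasurableSpace Ω] (M : ℝ → ℝ) (f : Ω → ℝ) (P : Measure Ω) : Prop :=
  AEMeasurable f P ∧ ∃ l : ℝ, 0 < l ∧ ∫⁻ x, ENNReal.ofReal (M (|f x| / l)) ∂P < ∞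

/-- The Luxemburg norm `inf {l > 0 : ∫ M (|f| / l) dP ≤ 1}`, with values in `[0, ∞]`
(the infimum of the empty set is `∞`). -/
noncomputable def luxemburgNorm {Ω : Type*} [MeasurableSpace Ω] (M : ℝ → ℝ) (f : Ω → ℝ)
    (P : Measure Ω) : ℝ≥0∞ :=
  sInf {t | ∃ l : ℝ, 0 < l ∧ ∫⁻ x, ENNReal.ofReal (M (|f x| / l)) ∂P ≤ 1 ∧ t = ENNReal.ofReal l}

/-- The Orlicz function `ψ₂(x) = exp (x²) - 1`. -/
noncomputable def psiTwo (x : ℝ) : ℝ := Real.exp (x ^ 2) - 1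

/-!
Let `X` have i.i.d. coordinates with density proportional to `exp (-|t| ^ p)`. For `p ≥ 2` this
density is dominated by a Gaussian one uniformly in `p`, so for `‖θ‖₂ = 1` the variable `⟨X, θ⟩` is
sub-Gaussian with a variance proxy independent of `p`, `n` and `θ`, and `𝔼 exp (s ⟨X, θ⟩²) ≤ 2`
for an absolute constant `s`.

The joint density of `X` is a function of `‖X‖_p`; hence `X / ‖X‖_p` follows the cone measure and
is independent of `‖X‖_p`. Integrating out the radius, Jensen's inequality replaces `‖X‖_p²` inside
the exponential by its mean, and this mean is at least a constant times `n ^ (2 / p)`: by the power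
mean inequality `‖X‖_p² ≥ n ^ (2 / p) ‖X‖₂² / n`, and the coordinates of `X` have second moments
bounded below because their density is bounded above.
-/

open ProbabilityTheory Real
open scoped NNReal

/-! ### Sub-Gaussian laws on the line -/

theorem exp_mul_sub_one_le {d s : ℝ} (hd₀ : 0 ≤ d) (hd₁ : d ≤ 1) :
    exp (d * s) - 1 ≤ d * (exp s - 1) := by
  have h := convexOn_exp.2 (mem_univ s) (mem_univ 0) hd₀ (sub_nonneg.2 hd₁) (by ring)
  simp only [smul_eq_mul, mul_zero, add_zero, exp_zero, mul_one] at h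
  linarith

theorem ofReal_exp_integral_le_lintegral {Ω : Type*} [MeasurableSpace Ω] {P : Measure Ω}
    [IsProbabilityMeasure P] {f : Ω → ℝ} (hf : Integrable f P) :
    ENNReal.ofReal (exp (∫ ω, f ω ∂P)) ≤ ∫⁻ ω, ENNReal.ofReal (exp (f ω)) ∂P := by
  by_cases hexp : Integrable (fun ω => exp (f ω)) P
  · rw [← ofReal_integral_eq_lintegral_ofReal hexp (ae_of_all _ fun _ => (exp_pos _).le)]
    exact ENNReal.ofReal_le_ofReal (convexOn_exp.map_integral_le continuousOn_exp isClosed_univ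
      (ae_of_all _ fun _ => mem_univ _) hf hexp)
  · have hmeas : AEStronglyMeasurable (fun ω => exp (f ω)) P :=
      continuous_exp.comp_aestronglyMeasurable hf.1
    have htop : ∫⁻ ω, ENNReal.ofReal (exp (f ω)) ∂P = ∞ := by
      by_contra h
      exact hexp ((lintegral_ofReal_ne_top_iff_integrable hmeas
        (ae_of_all _ fun _ => (exp_pos _).le)).1 h)
    exact htop ▸ le_top

section SubGaussian

theorem integral_exp_mul_eq_integral_cosh {μ : Measure ℝ} [μ.IsNegInvariant] {u : ℝ}
    (hint : Integrable (fun t => exp (u * t)) μ) :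
    ∫ t, exp (u * t) ∂μ = ∫ t, cosh (u * t) ∂μ := by
  have hneg : ∫ t, exp (-(u * t)) ∂μ = ∫ t, exp (u * t) ∂μ := by
    simpa only [mul_neg] using integral_neg_eq_self (fun t => exp (u * t)) μ
  have hint_neg : Integrable (fun t => exp (-(u * t))) μ := by
    simpa only [mul_neg] using hint.comp_neg
  simp only [cosh_eq, integral_div, integral_add hint hint_neg, hneg]
  ring

theorem exp_mul_le_mul_exp_half_sq (u t : ℝ) :
    exp (u * t) ≤ exp (u ^ 2 / 2) * exp (t ^ 2 / 2) := by
  rw [← exp_add, exp_le_exp]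
  linarith [two_mul_le_add_sq u t]

theorem integrable_exp_mul_of_integrable_exp_half_sq {μ : Measure ℝ}
    (hint : Integrable (fun t => exp (t ^ 2 / 2)) μ) (u : ℝ) :
    Integrable (fun t => exp (u * t)) μ :=
  (hint.const_mul (exp (u ^ 2 / 2))).mono' (by fun_prop)
    (ae_of_all _ fun t => by simpa only [norm_eq_abs, abs_exp] using exp_mul_le_mul_exp_half_sq u t)

variable {μ : Measure ℝ} [IsProbabilityMeasure μ] {K : ℝ}

theorem integral_exp_mul_le_of_sq_le_one [μ.IsNegInvariant]
    (hint : Integrable (fun t => exp (t ^ 2 / 2)) μ) (hK : ∫ t, exp (t ^ 2 / 2) ∂μ ≤ K) {u : ℝ}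
    (hu : u ^ 2 ≤ 1) : ∫ t, exp (u * t) ∂μ ≤ exp (K * u ^ 2) := by
  -- By symmetry `exp` may be replaced by `cosh`, which has no linear term at `0`; convexity of
  -- `exp` then pulls the factor `u ^ 2` out of the exponent.
  have hcosh (t : ℝ) : cosh (u * t) ≤ 1 + u ^ 2 * (exp (t ^ 2 / 2) - 1) := by
    have hconv := exp_mul_sub_one_le (s := t ^ 2 / 2) (sq_nonneg u) hu
    rw [← mul_div_assoc, ← mul_pow] at hconv
    linarith [cosh_le_exp_half_sq (u * t)]
  have hint_bound : Integrable (fun t => u ^ 2 * (exp (t ^ 2 / 2) - 1)) μ :=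
    (hint.sub (integrable_const 1)).const_mul _
  calc ∫ t, exp (u * t) ∂μ = ∫ t, cosh (u * t) ∂μ :=
      integral_exp_mul_eq_integral_cosh (integrable_exp_mul_of_integrable_exp_half_sq hint u)
    _ ≤ ∫ t, (1 + u ^ 2 * (exp (t ^ 2 / 2) - 1)) ∂μ :=
      integral_mono_of_nonneg (ae_of_all _ fun t => (cosh_pos _).le)
        ((integrable_const 1).add hint_bound) (ae_of_all _ hcosh)
    _ = 1 + u ^ 2 * (∫ t, exp (t ^ 2 / 2) ∂μ - 1) := by
      rw [integral_add (integrable_const 1) hint_bound, integral_const_mul,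
        integral_sub hint (integrable_const 1)]
      simp
    _ ≤ K * u ^ 2 + 1 := by nlinarith [sq_nonneg u]
    _ ≤ exp (K * u ^ 2) := add_one_le_exp _

theorem integral_exp_mul_le_of_one_le_sq
    (hint : Integrable (fun t => exp (t ^ 2 / 2)) μ) (hK : ∫ t, exp (t ^ 2 / 2) ∂μ ≤ K) {u : ℝ}
    (hu : 1 ≤ u ^ 2) : ∫ t, exp (u * t) ∂μ ≤ exp (K * u ^ 2) := by
  have hK₁ : 1 ≤ K :=
    calc (1 : ℝ) = ∫ _, 1 ∂μ := by simp
      _ ≤ ∫ t, exp (t ^ 2 / 2) ∂μ :=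
        integral_mono (integrable_const 1) hint fun t => one_le_exp (by positivity)
      _ ≤ K := hK
  calc ∫ t, exp (u * t) ∂μ ≤ ∫ t, exp (u ^ 2 / 2) * exp (t ^ 2 / 2) ∂μ :=
      integral_mono (integrable_exp_mul_of_integrable_exp_half_sq hint u) (hint.const_mul _)
        (exp_mul_le_mul_exp_half_sq u)
    _ ≤ exp (u ^ 2 / 2) * exp (K - 1) := by
      rw [integral_const_mul]
      gcongr
      linarith [add_one_le_exp (K - 1)]
    _ ≤ exp (K * u ^ 2) := by
      rw [← exp_add, exp_le_exp]
      nlinarith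

theorem hasSubgaussianMGF_id_of_integral_exp_half_sq_le {K : ℝ≥0} [μ.IsNegInvariant]
    (hint : Integrable (fun t => exp (t ^ 2 / 2)) μ) (hK : ∫ t, exp (t ^ 2 / 2) ∂μ ≤ K) :
    HasSubgaussianMGF id (2 * K) μ := by
  refine ⟨integrable_exp_mul_of_integrable_exp_half_sq hint, fun u => ?_⟩
  rw [NNReal.coe_mul, NNReal.coe_ofNat, mul_assoc, mul_div_cancel_left₀ _ two_ne_zero]
  rcases le_total (u ^ 2) 1 with hu | hu
  · exact integral_exp_mul_le_of_sq_le_one hint hK hu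
  · exact integral_exp_mul_le_of_one_le_sq hint hK hu

theorem lintegral_exp_mul_sq_gaussianReal {a : ℝ} (ha : 2 * a < 1) :
    ∫⁻ z, ENNReal.ofReal (exp (a * z ^ 2)) ∂gaussianReal 0 1 =
      ENNReal.ofReal (√(1 - 2 * a))⁻¹ := by
  have hb : 0 < 1 / 2 - a := by linarith
  have hmul (z : ℝ) : gaussianPDFReal 0 1 z * exp (a * z ^ 2) =
      (√(2 * π))⁻¹ * exp (-(1 / 2 - a) * z ^ 2) := by
    rw [gaussianPDFReal, mul_assoc, ← exp_add]
    simp only [NNReal.coe_one, mul_one, sub_zero]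
    ring_nf
  calc ∫⁻ z, ENNReal.ofReal (exp (a * z ^ 2)) ∂gaussianReal 0 1
      = ∫⁻ z, ENNReal.ofReal ((√(2 * π))⁻¹ * exp (-(1 / 2 - a) * z ^ 2)) := by
        rw [gaussianReal_of_var_ne_zero _ one_ne_zero,
          lintegral_withDensity_eq_lintegral_mul _ (by fun_prop) (by fun_prop)]
        simp only [Pi.mul_apply, gaussianPDF, ← hmul,
          ENNReal.ofReal_mul (gaussianPDFReal_nonneg 0 1 _)]
    _ = ENNReal.ofReal ((√(2 * π))⁻¹ * √(π / (1 / 2 - a))) := by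
        rw [← ofReal_integral_eq_lintegral_ofReal ((integrable_exp_neg_mul_sq hb).const_mul _)
          (ae_of_all _ fun _ => by positivity), integral_const_mul, integral_gaussian]
    _ = ENNReal.ofReal (√(1 - 2 * a))⁻¹ := by
        rw [← sqrt_inv, ← sqrt_inv, ← sqrt_mul (by positivity)]
        congr 2
        have : 1 - 2 * a ≠ 0 := by linarith
        field_simp

theorem lintegral_exp_mul_sq_le_of_hasSubgaussianMGF {Ω : Type*} [MeasurableSpace Ω]
    {P : Measure Ω} [SFinite P] {X : Ω → ℝ} {c : ℝ≥0} (hX : HasSubgaussianMGF X c P) {s : ℝ}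
    (hs : 0 ≤ s) (hsc : 2 * (s * c) < 1) :
    ∫⁻ ω, ENNReal.ofReal (exp (s * X ω ^ 2)) ∂P ≤ ENNReal.ofReal (√(1 - 2 * (s * c)))⁻¹ := by
  -- `exp (s x²)` is the average of `exp (z √(2s) x)` over a standard Gaussian `z`; after exchanging
  -- the integrals the sub-Gaussian bound leaves a Gaussian integral in `z`.
  have hmgf (x : ℝ) : ENNReal.ofReal (exp (s * x ^ 2)) =
      ∫⁻ z, ENNReal.ofReal (exp (z * (√(2 * s) * x))) ∂gaussianReal 0 1 := by
    have h := congrFun (mgf_id_gaussianReal (μ := 0) (v := 1)) (√(2 * s) * x)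
    simp only [mgf, id_eq, zero_mul, NNReal.coe_one, one_mul, zero_add, mul_pow] at h
    rw [sq_sqrt (by positivity)] at h
    simp only [mul_comm _ (√(2 * s) * x)]
    rw [← ofReal_integral_eq_lintegral_ofReal (integrable_exp_mul_gaussianReal _)
      (ae_of_all _ fun _ => (exp_pos _).le), h]
    ring_nf
  have hmeas : AEMeasurable X P := hX.aemeasurable
  calc ∫⁻ ω, ENNReal.ofReal (exp (s * X ω ^ 2)) ∂P
      = ∫⁻ ω, ∫⁻ z, ENNReal.ofReal (exp (z * (√(2 * s) * X ω))) ∂gaussianReal 0 1 ∂P := by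
        simp only [hmgf]
    _ = ∫⁻ z, ∫⁻ ω, ENNReal.ofReal (exp (z * √(2 * s) * X ω)) ∂P ∂gaussianReal 0 1 := by
        simp only [mul_assoc]
        exact lintegral_lintegral_swap (by fun_prop)
    _ ≤ ∫⁻ z, ENNReal.ofReal (exp (s * c * z ^ 2)) ∂gaussianReal 0 1 := by
        refine lintegral_mono fun z => ?_
        rw [← ofReal_integral_eq_lintegral_ofReal (hX.integrable_exp_mul _)
          (ae_of_all _ fun _ => (exp_pos _).le)]
        refine ENNReal.ofReal_le_ofReal ((hX.mgf_le _).trans_eq ?_)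
        rw [mul_pow, sq_sqrt (by positivity)]
        ring_nf
    _ = ENNReal.ofReal (√(1 - 2 * (s * c)))⁻¹ := lintegral_exp_mul_sq_gaussianReal hsc

end SubGaussian

theorem le_integral_sq_of_le_smul_volume {μ : Measure ℝ} [IsProbabilityMeasure μ] {D : ℝ≥0}
    (hD : μ ≤ D • volume) (hint : Integrable (fun t => t ^ 2) μ) :
    1 / (32 * (D : ℝ) ^ 2) ≤ ∫ t, t ^ 2 ∂μ := by
  have hD₀ : 0 < D := by
    refine pos_iff_ne_zero.2 fun h => IsProbabilityMeasure.ne_zero μ ?_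
    simpa only [h, zero_smul, Measure.nonpos_iff_eq_zero'] using hD
  set a : ℝ := 1 / (4 * D)
  have ha : 0 < a := by positivity
  have hsmall : μ.real (Ioo (-a) a) ≤ 1 / 2 :=
    calc μ.real (Ioo (-a) a) ≤ (D • (volume : Measure ℝ)).real (Ioo (-a) a) :=
        ENNReal.toReal_mono measure_Ioo_lt_top.ne (hD _)
      _ = D * (a - -a) := by
        rw [measureReal_nnreal_smul_apply, volume_real_Ioo_of_le (by linarith)]
      _ = 1 / 2 := by simp only [a]; field_simp; norm_num
  have hlarge : 1 / 2 ≤ μ.real {t | a ^ 2 ≤ t ^ 2} := by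
    have hcompl : {t : ℝ | a ^ 2 ≤ t ^ 2} = (Ioo (-a) a)ᶜ := by
      ext t
      rw [mem_ofPred_eq, mem_compl_iff, mem_Ioo, ← abs_lt, not_lt, sq_le_sq, abs_of_pos ha]
    rw [hcompl, probReal_compl_eq_one_sub measurableSet_Ioo]
    linarith
  calc 1 / (32 * (D : ℝ) ^ 2) = a ^ 2 * (1 / 2) := by simp only [a]; field_simp; norm_num
    _ ≤ a ^ 2 * μ.real {t | a ^ 2 ≤ t ^ 2} := by gcongr
    _ ≤ ∫ t, t ^ 2 ∂μ := mul_meas_ge_le_integral_of_nonneg (ae_of_all _ sq_nonneg) hint _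

/-! ### The density `exp (-|t| ^ p)` -/

theorem sq_sub_one_le_abs_rpow {p : ℝ} (hp : 2 ≤ p) (t : ℝ) : t ^ 2 - 1 ≤ |t| ^ p := by
  rcases le_total |t| 1 with ht | ht
  · have hsq : t ^ 2 ≤ 1 := (sq_le_one_iff_abs_le_one t).2 ht
    linarith [rpow_nonneg (abs_nonneg t) p]
  · have hpow := rpow_le_rpow_of_exponent_le ht hp
    rw [rpow_two, sq_abs] at hpow
    linarith

theorem integrable_exp_neg_abs_rpow {p : ℝ} (hp : 0 < p) :
    Integrable fun t : ℝ => exp (-|t| ^ p) := by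
  refine .of_integral_ne_zero ?_
  rw [integral_comp_abs (f := fun t => exp (-t ^ p)), integral_exp_neg_rpow hp]
  exact mul_ne_zero two_ne_zero (Gamma_pos_of_pos (by positivity)).ne'

theorem two_mul_exp_neg_one_le_integral_exp_neg_abs_rpow {p : ℝ} (hp : 0 < p) :
    2 * exp (-1) ≤ ∫ t : ℝ, exp (-|t| ^ p) :=
  calc 2 * exp (-1) = ∫ _ in Icc (-1 : ℝ) 1, exp (-1) := by
        rw [setIntegral_const, volume_real_Icc_of_le (by norm_num), smul_eq_mul]
        norm_num
    _ ≤ ∫ t in Icc (-1 : ℝ) 1, exp (-|t| ^ p) :=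
        setIntegral_mono_on (integrable_const _) (integrable_exp_neg_abs_rpow hp).integrableOn
          measurableSet_Icc fun t ht => exp_le_exp.2 <| neg_le_neg <|
            rpow_le_one (abs_nonneg t) (abs_le.2 ht) hp.le
    _ ≤ ∫ t : ℝ, exp (-|t| ^ p) :=
        setIntegral_le_integral (integrable_exp_neg_abs_rpow hp)
          (ae_of_all _ fun _ => (exp_pos _).le)

theorem isNegInvariant_tilted {G : Type*} [MeasurableSpace G] [InvolutiveNeg G] [MeasurableNeg G]
    {μ : Measure G} [μ.IsNegInvariant] {f : G → ℝ} (hf : ∀ x, f (-x) = f x) :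
    (μ.tilted f).IsNegInvariant where
  neg_eq_self := by
    refine Measure.ext_of_lintegral _ fun g hg => ?_
    calc ∫⁻ x, g x ∂(μ.tilted f).neg = ∫⁻ x, g (-x) ∂μ.tilted f :=
          lintegral_map hg measurable_neg
      _ = ∫⁻ x, ENNReal.ofReal (exp (f (-x)) / ∫ y, exp (f y) ∂μ) * g (-x) ∂μ := by
          simp only [lintegral_tilted, hf]
      _ = ∫⁻ x, g x ∂μ.tilted f := by
          rw [lintegral_neg_eq_self fun x =>
            ENNReal.ofReal (exp (f x) / ∫ y, exp (f y) ∂μ) * g x, lintegral_tilted]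

/-- The symmetric generalized Gaussian law on `ℝ`, with density proportional to `exp (-|t| ^ p)`. -/
noncomputable def expPowerMeasure (p : ℝ) : Measure ℝ :=
  volume.tilted fun t => -|t| ^ p

namespace expPowerMeasure

variable {p : ℝ}

theorem isProbabilityMeasure (hp : 0 < p) : IsProbabilityMeasure (expPowerMeasure p) :=
  isProbabilityMeasure_tilted (integrable_exp_neg_abs_rpow hp)

instance : (expPowerMeasure p).IsNegInvariant :=
  isNegInvariant_tilted fun t => by rw [abs_neg]

theorem le_smul_volume (hp : 0 < p) :
    expPowerMeasure p ≤ (exp 1 / 2).toNNReal • volume := by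
  have hdens (t : ℝ) : exp (-|t| ^ p) / ∫ s, exp (-|s| ^ p) ≤ exp 1 / 2 := by
    have hmass := two_mul_exp_neg_one_le_integral_exp_neg_abs_rpow hp
    calc exp (-|t| ^ p) / ∫ s, exp (-|s| ^ p) ≤ 1 / (2 * exp (-1)) := by
          gcongr
          exact exp_le_one_iff.2 (neg_nonpos.2 (by positivity))
      _ = exp 1 / 2 := by rw [exp_neg]; field_simp
  calc expPowerMeasure p ≤ volume.withDensity fun _ => ENNReal.ofReal (exp 1 / 2) :=
        withDensity_mono (ae_of_all _ fun t => ENNReal.ofReal_le_ofReal (hdens t))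
    _ = (exp 1 / 2).toNNReal • volume := withDensity_const _

theorem exp_neg_abs_rpow_add_half_sq_le (hp : 2 ≤ p) (t : ℝ) :
    exp (-|t| ^ p + t ^ 2 / 2) ≤ exp 1 * exp (-(1 / 2) * t ^ 2) := by
  rw [← exp_add, exp_le_exp]
  linarith [sq_sub_one_le_abs_rpow hp t]

theorem integrable_exp_half_sq (hp : 2 ≤ p) :
    Integrable (fun t => exp (t ^ 2 / 2)) (expPowerMeasure p) := by
  rw [expPowerMeasure, integrable_tilted_iff (integrable_exp_neg_abs_rpow (by linarith))]
  refine ((integrable_exp_neg_mul_sq one_half_pos).const_mul (exp 1)).mono' (by fun_prop)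
    (ae_of_all _ fun t => ?_)
  rw [smul_eq_mul, ← exp_add, norm_eq_abs, abs_exp]
  exact exp_neg_abs_rpow_add_half_sq_le hp t

theorem integral_exp_half_sq_le (hp : 2 ≤ p) :
    ∫ t, exp (t ^ 2 / 2) ∂expPowerMeasure p ≤ exp 2 * √(2 * π) / 2 := by
  have hmass := two_mul_exp_neg_one_le_integral_exp_neg_abs_rpow (p := p) (by linarith)
  have hnum : ∫ t : ℝ, exp (-|t| ^ p + t ^ 2 / 2) ≤ exp 1 * √(2 * π) :=
    calc ∫ t : ℝ, exp (-|t| ^ p + t ^ 2 / 2) ≤ ∫ t : ℝ, exp 1 * exp (-(1 / 2) * t ^ 2) :=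
          integral_mono_of_nonneg (ae_of_all _ fun _ => (exp_pos _).le)
            ((integrable_exp_neg_mul_sq one_half_pos).const_mul _)
            (ae_of_all _ (exp_neg_abs_rpow_add_half_sq_le hp))
      _ = exp 1 * √(2 * π) := by
          rw [integral_const_mul, integral_gaussian, div_div_eq_mul_div, div_one, mul_comm π]
  calc ∫ t, exp (t ^ 2 / 2) ∂expPowerMeasure p
      = (∫ t : ℝ, exp (-|t| ^ p + t ^ 2 / 2)) / ∫ t : ℝ, exp (-|t| ^ p) := by
        simp only [expPowerMeasure, integral_exp_tilted, Pi.add_apply]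
    _ ≤ exp 1 * √(2 * π) / (2 * exp (-1)) := by gcongr
    _ = exp 2 * √(2 * π) / 2 := by
        rw [exp_neg, show (2 : ℝ) = 1 + 1 by norm_num, exp_add]
        field_simp

/-- The variance proxy `exp 2 * √(2 * π)`, common to all the laws `expPowerMeasure p`
with `2 ≤ p`. -/
noncomputable def varianceProxy : ℝ≥0 :=
  2 * (exp 2 * √(2 * π) / 2).toNNReal

theorem varianceProxy_pos : 0 < varianceProxy :=
  mul_pos two_pos (toNNReal_pos.2 (by positivity))

theorem hasSubgaussianMGF_id (hp : 2 ≤ p) :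
    HasSubgaussianMGF id varianceProxy (expPowerMeasure p) :=
  have := isProbabilityMeasure (p := p) (by linarith)
  hasSubgaussianMGF_id_of_integral_exp_half_sq_le (integrable_exp_half_sq hp)
    ((integral_exp_half_sq_le hp).trans (le_coe_toNNReal _))

theorem integrable_sq (hp : 2 ≤ p) : Integrable (fun t => t ^ 2) (expPowerMeasure p) :=
  ((hasSubgaussianMGF_id hp).memLp 2).integrable_sq

theorem le_integral_sq (hp : 2 ≤ p) :
    1 / (8 * exp 1 ^ 2) ≤ ∫ t, t ^ 2 ∂expPowerMeasure p := by
  have := isProbabilityMeasure (p := p) (by linarith)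
  have h := le_integral_sq_of_le_smul_volume (le_smul_volume (by linarith)) (integrable_sq hp)
  rw [coe_toNNReal _ (by positivity)] at h
  convert h using 1
  ring

end expPowerMeasure

theorem pi_tilted {ι : Type*} [Fintype ι] {E : ι → Type*} [∀ i, MeasurableSpace (E i)]
    (μ : ∀ i, Measure (E i)) [∀ i, SigmaFinite (μ i)] (f : ∀ i, E i → ℝ) :
    Measure.pi (fun i => (μ i).tilted (f i)) =
      (Measure.pi μ).tilted fun x => ∑ i, f i (x i) := by
  refine Measure.pi_eq fun s hs => ?_
  have hnonneg (i : ι) : 0 ≤ ∫ y in s i, exp (f i y) / ∫ z, exp (f i z) ∂μ i ∂μ i := by positivity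
  rw [tilted_apply_eq_ofReal_integral' _ (.univ_pi hs)]
  simp only [tilted_apply_eq_ofReal_integral' _ (hs _),
    ← ENNReal.ofReal_prod_of_nonneg fun i _ => hnonneg i, exp_sum,
    integral_fintype_prod_eq_prod fun i y => exp (f i y), ← Finset.prod_div_distrib,
    Measure.restrict_pi_pi,
    integral_fintype_prod_eq_prod fun i y => exp (f i y) / ∫ z, exp (f i z) ∂μ i]

theorem measurePreserving_tilted {α β : Type*} [MeasurableSpace α] [MeasurableSpace β]
    {μ : Measure α} {ν : Measure β} {e : α ≃ᵐ β} (he : MeasurePreserving e μ ν) (f : β → ℝ) :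
    MeasurePreserving e (μ.tilted (f ∘ e)) (ν.tilted f) := by
  refine ⟨e.measurable, Measure.ext_of_lintegral _ fun g _ => ?_⟩
  have hmass : ∫ x, exp (f (e x)) ∂μ = ∫ y, exp (f y) ∂ν :=
    he.integral_comp e.measurableEmbedding fun y => exp (f y)
  rw [lintegral_map_equiv, lintegral_tilted, lintegral_tilted,
    ← he.lintegral_comp_emb e.measurableEmbedding]
  simp only [Function.comp_apply, hmass]

theorem hasSubgaussianMGF_sum_mul_pi {ι : Type*} [Fintype ι] {μ : ι → Measure ℝ}
    [∀ i, IsProbabilityMeasure (μ i)] {c : ℝ≥0} (h : ∀ i, HasSubgaussianMGF id c (μ i))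
    (θ : ι → ℝ) :
    HasSubgaussianMGF (fun y : ι → ℝ => ∑ i, θ i * y i) (∑ i, ‖θ i‖₊ ^ 2 * c) (Measure.pi μ) := by
  refine .sum_of_iIndepFun (iIndepFun_pi (X := fun i t => θ i * t) fun i => by fun_prop)
    fun i _ => ?_
  have hi := h i
  rw [← (measurePreserving_eval μ i).map_eq] at hi
  convert (hi.of_map (measurePreserving_eval μ i).aemeasurable).const_mul (θ i)
  · rfl
  · exact congrArg (· * c) (NNReal.eq (sq_abs (θ i)))

section EllpNorm

variable {n : ℕ} {p : ℝ} (x : EuclideanSpace ℝ (Fin n))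

theorem sum_abs_rpow_nonneg : 0 ≤ ∑ i, |x i| ^ p :=
  Finset.sum_nonneg fun _ _ => by positivity

theorem ellpNorm_nonneg : 0 ≤ ellpNorm p x :=
  rpow_nonneg (sum_abs_rpow_nonneg x) _

theorem ellpNorm_rpow (hp : p ≠ 0) : ellpNorm p x ^ p = ∑ i, |x i| ^ p := by
  rw [ellpNorm, ← rpow_mul (sum_abs_rpow_nonneg x), one_div_mul_cancel hp, rpow_one]

end EllpNorm

/-- The law on `ℝⁿ` with density proportional to `exp (-‖x‖_p ^ p)`. -/
noncomputable def expEllpNormMeasure (n : ℕ) (p : ℝ) : Measure (EuclideanSpace ℝ (Fin n)) :=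
  volume.tilted fun x => -ellpNorm p x ^ p

namespace expEllpNormMeasure

variable {n : ℕ} {p : ℝ}

theorem measurePreserving_ofLp (n : ℕ) (hp : p ≠ 0) :
    MeasurePreserving (MeasurableEquiv.toLp 2 (Fin n → ℝ)).symm (expEllpNormMeasure n p)
      (Measure.pi fun _ => expPowerMeasure p) := by
  have h := measurePreserving_tilted (e := (MeasurableEquiv.toLp 2 (Fin n → ℝ)).symm)
    (PiLp.volume_preserving_ofLp (Fin n)) fun y => ∑ i, -|y i| ^ p
  simp only [expPowerMeasure, pi_tilted, ← volume_pi]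
  convert h using 1
  refine congrArg (Measure.tilted volume) (funext fun x => ?_)
  simp [ellpNorm_rpow x hp]

theorem isProbabilityMeasure (hp : 0 < p) : IsProbabilityMeasure (expEllpNormMeasure n p) := by
  have := expPowerMeasure.isProbabilityMeasure hp
  have hmp := measurePreserving_ofLp n hp.ne'
  rw [← hmp.symm.map_eq]
  exact Measure.isProbabilityMeasure_map (by fun_prop)

theorem measurePreserving_apply (hp : 0 < p) (i : Fin n) :
    MeasurePreserving (fun x : EuclideanSpace ℝ (Fin n) => x i) (expEllpNormMeasure n p)
      (expPowerMeasure p) := by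
  have := expPowerMeasure.isProbabilityMeasure hp
  exact (measurePreserving_eval _ i).comp (measurePreserving_ofLp n hp.ne')

theorem hasSubgaussianMGF_inner (hp : 2 ≤ p) {θ : EuclideanSpace ℝ (Fin n)} (hθ : ‖θ‖ = 1) :
    HasSubgaussianMGF (fun x => inner ℝ x θ) expPowerMeasure.varianceProxy
      (expEllpNormMeasure n p) := by
  have := expPowerMeasure.isProbabilityMeasure (p := p) (by linarith)
  have hmp := measurePreserving_ofLp n (p := p) (by linarith)
  have hsum := hasSubgaussianMGF_sum_mul_pi
    (fun _ : Fin n => expPowerMeasure.hasSubgaussianMGF_id hp) θ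
  rw [← hmp.map_eq] at hsum
  have hnorm : ∑ i, ‖θ i‖₊ ^ 2 = 1 := by
    rw [← NNReal.coe_inj]
    simpa [hθ] using (EuclideanSpace.norm_sq_eq θ).symm
  simpa [Function.comp_def, ← Finset.sum_mul, hnorm, PiLp.inner_apply]
    using hsum.of_map hmp.aemeasurable

end expEllpNormMeasure

/-! ### Polar decomposition of the Lebesgue measure -/

theorem map_withDensity_comp {α β : Type*} [MeasurableSpace α] [MeasurableSpace β] {μ : Measure α}
    {f : α → β} (hf : Measurable f) {w : β → ℝ≥0∞} (hw : Measurable w) :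
    (μ.withDensity (w ∘ f)).map f = (μ.map f).withDensity w := by
  ext s hs
  rw [Measure.map_apply hf hs, withDensity_apply _ (hf hs), withDensity_apply _ hs,
    setLIntegral_map hs hw hf]
  rfl

section Polar

variable {n : ℕ} {p : ℝ}

/-- The radial projection `x ↦ x / ‖x‖_p` onto the unit sphere of `ℓ_p^n`; it sends `0` to `0`. -/
noncomputable def lpProj (p : ℝ) (x : EuclideanSpace ℝ (Fin n)) : EuclideanSpace ℝ (Fin n) :=
  (ellpNorm p x)⁻¹ • x

theorem measurable_lpProj : Measurable (lpProj p : EuclideanSpace ℝ (Fin n) → _) :=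
  (measurable_ellpNorm n p).inv.smul measurable_id

theorem ellpNorm_eq_zero_iff (hp : 0 < p) {x : EuclideanSpace ℝ (Fin n)} :
    ellpNorm p x = 0 ↔ x = 0 := by
  rw [ellpNorm, rpow_eq_zero (sum_abs_rpow_nonneg x) (by positivity),
    Finset.sum_eq_zero_iff_of_nonneg fun _ _ => by positivity]
  simp [rpow_eq_zero (abs_nonneg _) hp.ne', PiLp.ext_iff]

theorem ellpNorm_smul_lpProj (hp : 0 < p) (x : EuclideanSpace ℝ (Fin n)) :
    ellpNorm p x • lpProj p x = x := by
  rcases eq_or_ne x 0 with rfl | hx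
  · rw [lpProj, smul_zero, smul_zero]
  · rw [lpProj, smul_inv_smul₀ ((ellpNorm_eq_zero_iff hp).not.2 hx)]

theorem lpProj_smul (hp : 1 ≤ p) {r : ℝ} (hr : 0 < r) (x : EuclideanSpace ℝ (Fin n)) :
    lpProj p (r • x) = lpProj p x := by
  rw [lpProj, lpProj, ellpNorm_smul hp hr.le, smul_smul, mul_inv_rev, mul_assoc,
    inv_mul_cancel₀ hr.ne', mul_one]

theorem lpProj_mem_lpSphere (hp : 1 ≤ p) {x : EuclideanSpace ℝ (Fin n)} (hx : x ≠ 0) :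
    lpProj p x ∈ lpSphere n p := by
  have hN : ellpNorm p x ≠ 0 := (ellpNorm_eq_zero_iff (by linarith)).not.2 hx
  rw [lpProj, lpSphere, mem_ofPred_eq, ellpNorm_smul hp (inv_nonneg.2 (ellpNorm_nonneg x)),
    inv_mul_cancel₀ hN]

theorem volume_ellpNorm_le [NeZero n] (hp : 1 ≤ p) (r : ℝ) :
    volume {x : EuclideanSpace ℝ (Fin n) | ellpNorm p x ≤ r} = ENNReal.ofReal r ^ n *
      ENNReal.ofReal ((2 * Gamma (1 / p + 1)) ^ n / Gamma (n / p + 1)) := by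
  have h := volume_sum_rpow_le (ι := Fin n) hp r
  rw [Fintype.card_fin] at h
  rw [← h]
  have hmp : MeasurePreserving (MeasurableEquiv.toLp 2 (Fin n → ℝ)).symm volume volume :=
    PiLp.volume_preserving_ofLp (Fin n)
  exact hmp.measure_preimage_equiv {y | (∑ i, |y i| ^ p) ^ (1 / p) ≤ r}

theorem volume_ellpNorm_le_eq_mul [NeZero n] (hp : 1 ≤ p) (r : ℝ) :
    volume {x : EuclideanSpace ℝ (Fin n) | ellpNorm p x ≤ r} =
      ENNReal.ofReal r ^ n * volume (lpBall n p) := by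
  rw [lpBall, volume_ellpNorm_le hp, volume_ellpNorm_le hp, ENNReal.ofReal_one, one_pow, one_mul]

theorem volume_lpBall_pos [NeZero n] (hp : 1 ≤ p) : 0 < volume (lpBall n p) := by
  have hΓ : 0 < Gamma (1 / p + 1) := Gamma_pos_of_pos (by positivity)
  have hΓn : 0 < Gamma (n / p + 1) := Gamma_pos_of_pos (by positivity)
  rw [lpBall, volume_ellpNorm_le hp, ENNReal.ofReal_one, one_pow, one_mul]
  exact ENNReal.ofReal_pos.2 (div_pos (pow_pos (mul_pos two_pos hΓ) n) hΓn)

theorem volume_lpBall_lt_top [NeZero n] (hp : 1 ≤ p) : volume (lpBall n p) < ∞ := by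
  rw [lpBall, volume_ellpNorm_le hp, ENNReal.ofReal_one, one_pow, one_mul]
  exact ENNReal.ofReal_lt_top

theorem volume_lpProj_preimage_inter_ellpNorm_le [NeZero n] (hp : 1 ≤ p)
    (A : Set (EuclideanSpace ℝ (Fin n))) (r : ℝ) :
    volume (lpProj p ⁻¹' A ∩ {x | ellpNorm p x ≤ r}) =
      ENNReal.ofReal r ^ n * volume (lpProj p ⁻¹' A ∩ lpBall n p) := by
  rcases le_or_gt r 0 with hr | hr
  · rw [ENNReal.ofReal_of_nonpos hr, zero_pow (NeZero.ne n), zero_mul]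
    refine measure_mono_null inter_subset_right ?_
    rw [volume_ellpNorm_le_eq_mul hp, ENNReal.ofReal_of_nonpos hr, zero_pow (NeZero.ne n), zero_mul]
  · have hscale : lpProj p ⁻¹' A ∩ lpBall n p =
        (r • ·) ⁻¹' (lpProj p ⁻¹' A ∩ {x | ellpNorm p x ≤ r}) := by
      ext x
      simp only [lpBall, mem_inter_iff, mem_preimage, mem_ofPred_eq, lpProj_smul hp hr,
        ellpNorm_smul hp hr.le, mul_le_iff_le_one_right hr]
    rw [hscale, Measure.addHaar_preimage_smul _ hr.ne', finrank_euclideanSpace_fin, ← mul_assoc,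
      ← ENNReal.ofReal_pow hr.le, ← ENNReal.ofReal_mul (by positivity), abs_of_pos (by positivity),
      mul_inv_cancel₀ (by positivity), ENNReal.ofReal_one, one_mul]

theorem coneMeasure_apply (hp : 1 ≤ p) {B : Set (lpSphere n p)} (hB : MeasurableSet B) :
    coneMeasure n p hp B = volume (puncturedCone B) / volume (lpBall n p) := by
  rw [coneMeasure, Measure.ofMeasurable_apply _ hB, volume_coneOver hp]

theorem coneMeasure_preimage_coe [NeZero n] (hp : 1 ≤ p) {A : Set (EuclideanSpace ℝ (Fin n))}
    (hA : MeasurableSet A) :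
    coneMeasure n p hp (Subtype.val ⁻¹' A) =
      volume (lpProj p ⁻¹' A ∩ lpBall n p) / volume (lpBall n p) := by
  rw [coneMeasure_apply hp (measurable_subtype_coe hA)]
  congr 1
  refine measure_congr ?_
  filter_upwards [Measure.ae_ne volume 0] with x hx
  have hproj := lpProj_mem_lpSphere hp hx
  refine propext ⟨?_, fun ⟨hxA, hle⟩ => ⟨hle, ⟨_, hproj⟩, hxA, rfl⟩⟩
  rintro ⟨hle, y, hyA, hy⟩
  exact ⟨show (ellpNorm p x)⁻¹ • x ∈ A from hy ▸ hyA, hle⟩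

theorem isProbabilityMeasure_coneMeasure [NeZero n] (hp : 1 ≤ p) :
    IsProbabilityMeasure (coneMeasure n p hp) := by
  have h := coneMeasure_preimage_coe (n := n) hp .univ
  rw [preimage_univ, preimage_univ, univ_inter,
    ENNReal.div_self (volume_lpBall_pos hp).ne' (volume_lpBall_lt_top hp).ne] at h
  exact ⟨h⟩

theorem map_lpProj_ellpNorm_volume [NeZero n] (hp : 1 ≤ p) :
    (volume : Measure (EuclideanSpace ℝ (Fin n))).map (fun x => (lpProj p x, ellpNorm p x)) =
      ((coneMeasure n p hp).map Subtype.val).prod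
        (volume.map (ellpNorm p : EuclideanSpace ℝ (Fin n) → ℝ)) := by
  have := isProbabilityMeasure_coneMeasure (n := n) hp
  have hN := measurable_ellpNorm n p
  have hIic (r : ℝ) : volume.map (ellpNorm p : EuclideanSpace ℝ (Fin n) → ℝ) (Iic r) =
      ENNReal.ofReal r ^ n * volume (lpBall n p) := by
    rw [Measure.map_apply hN measurableSet_Iic]
    exact volume_ellpNorm_le_eq_mul hp r
  let spanning : (volume.map (ellpNorm p : EuclideanSpace ℝ (Fin n) → ℝ)).FiniteSpanningSetsIn
      (range Iic) :=
    { set := fun k => Iic k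
      set_mem := fun k => mem_range_self _
      finite := fun k => by
        rw [hIic]
        exact ENNReal.mul_lt_top (by finiteness) (volume_lpBall_lt_top hp)
      spanning := iUnion_eq_univ_iff.2 exists_nat_ge }
  refine (Measure.prod_eq_generateFrom MeasurableSpace.generateFrom_measurableSet
    (borel_eq_generateFrom_Iic ℝ).symm MeasurableSpace.isPiSystem_measurableSet isPiSystem_Iic
    (Measure.toFiniteSpanningSetsIn _) spanning ?_).symm
  rintro A (hA : MeasurableSet A) _ ⟨r, rfl⟩
  rw [Measure.map_apply (measurable_lpProj.prodMk hN) (hA.prod measurableSet_Iic), hIic,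
    Measure.map_apply measurable_subtype_coe hA, coneMeasure_preimage_coe hp hA, mk_preimage_prod]
  calc volume (lpProj p ⁻¹' A ∩ ellpNorm p ⁻¹' Iic r)
      = ENNReal.ofReal r ^ n * volume (lpProj p ⁻¹' A ∩ lpBall n p) :=
        volume_lpProj_preimage_inter_ellpNorm_le hp A r
    _ = volume (lpProj p ⁻¹' A ∩ lpBall n p) / volume (lpBall n p) *
          (ENNReal.ofReal r ^ n * volume (lpBall n p)) := by
        rw [mul_left_comm, ENNReal.div_mul_cancel (volume_lpBall_pos hp).ne'
          (volume_lpBall_lt_top hp).ne]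

theorem map_lpProj_ellpNorm_withDensity [NeZero n] (hp : 1 ≤ p) {w : ℝ → ℝ≥0∞}
    (hw : Measurable w) :
    (volume.withDensity (w ∘ ellpNorm p)).map
        (fun x : EuclideanSpace ℝ (Fin n) => (lpProj p x, ellpNorm p x)) =
      ((coneMeasure n p hp).map Subtype.val).prod
        ((volume.withDensity (w ∘ ellpNorm p)).map
          (ellpNorm p : EuclideanSpace ℝ (Fin n) → ℝ)) := by
  have := isProbabilityMeasure_coneMeasure (n := n) hp
  have hN := measurable_ellpNorm n p
  have hpair : Measurable fun x : EuclideanSpace ℝ (Fin n) => (lpProj p x, ellpNorm p x) :=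
    measurable_lpProj.prodMk hN
  have hw' : Measurable fun z : EuclideanSpace ℝ (Fin n) × ℝ => w z.2 := hw.comp measurable_snd
  rw [map_withDensity_comp hN hw, prod_withDensity_right hw, ← map_lpProj_ellpNorm_volume hp,
    ← map_withDensity_comp hpair hw']
  simp only [Function.comp_def]

theorem lintegral_withDensity_comp_ellpNorm [NeZero n] (hp : 1 ≤ p) {w : ℝ → ℝ≥0∞}
    (hw : Measurable w) {F : EuclideanSpace ℝ (Fin n) → ℝ≥0∞} (hF : Measurable F) :
    ∫⁻ x, F x ∂volume.withDensity (w ∘ ellpNorm p) =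
      ∫⁻ y : lpSphere n p,
        ∫⁻ x : EuclideanSpace ℝ (Fin n), F (ellpNorm p x • y) ∂volume.withDensity (w ∘ ellpNorm p)
        ∂coneMeasure n p hp := by
  have hN := measurable_ellpNorm n p
  have hG : Measurable fun z : EuclideanSpace ℝ (Fin n) × ℝ => F (z.2 • z.1) := by fun_prop
  set γ : Measure (EuclideanSpace ℝ (Fin n)) := volume.withDensity (w ∘ ellpNorm p) with hγ
  calc ∫⁻ x, F x ∂γ = ∫⁻ x, F (ellpNorm p x • lpProj p x) ∂γ := by
        simp only [ellpNorm_smul_lpProj (zero_lt_one.trans_le hp)]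
    _ = ∫⁻ z, F (z.2 • z.1) ∂((coneMeasure n p hp).map Subtype.val).prod (γ.map (ellpNorm p)) := by
        rw [hγ, ← map_lpProj_ellpNorm_withDensity hp hw,
          lintegral_map hG (measurable_lpProj.prodMk hN)]
    _ = ∫⁻ y : lpSphere n p, ∫⁻ r, F (r • y) ∂γ.map (ellpNorm p) ∂coneMeasure n p hp := by
        rw [lintegral_prod _ hG.aemeasurable,
          lintegral_map hG.lintegral_prod_right' measurable_subtype_coe]
    _ = ∫⁻ y : lpSphere n p, ∫⁻ x, F (ellpNorm p x • y) ∂γ ∂coneMeasure n p hp :=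
        lintegral_congr fun y => lintegral_map (hG.comp measurable_prodMk_left) hN

end Polar

/-! ### Exponential square moments of the cone measure -/

theorem sq_mul_norm_sq_div_le_ellpNorm_sq {n : ℕ} [NeZero n] {p : ℝ} (hp : 2 ≤ p)
    (x : EuclideanSpace ℝ (Fin n)) :
    ((n : ℝ) ^ (1 / p)) ^ 2 * (‖x‖ ^ 2 / n) ≤ ellpNorm p x ^ 2 := by
  have hn : (0 : ℝ) < n := Nat.cast_pos.2 (NeZero.pos n)
  have hexp : 1 / (p / 2) = 1 / p * 2 := by field_simp
  have hpow (i : Fin n) : (x i ^ 2) ^ (p / 2) = |x i| ^ p := by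
    rw [← sq_abs, ← rpow_two, ← rpow_mul (abs_nonneg _), mul_div_cancel₀ p two_ne_zero]
  have hmean : ‖x‖ ^ 2 / n ≤ ((∑ i, |x i| ^ p) / n) ^ (1 / (p / 2)) := by
    have h := arith_mean_le_rpow_mean Finset.univ (fun _ => (n : ℝ)⁻¹) (fun i => x i ^ 2)
      (fun _ _ => by positivity) (by simp [hn.ne']) (fun _ _ => sq_nonneg _)
      (p := p / 2) (by linarith)
    simp only [hpow, ← Finset.mul_sum, ← EuclideanSpace.real_norm_sq_eq] at h
    simpa only [inv_mul_eq_div] using h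
  calc ((n : ℝ) ^ (1 / p)) ^ 2 * (‖x‖ ^ 2 / n)
      ≤ ((n : ℝ) ^ (1 / p)) ^ 2 * ((∑ i, |x i| ^ p) / n) ^ (1 / (p / 2)) := by gcongr
    _ = ellpNorm p x ^ 2 := by
        rw [hexp, rpow_mul (by positivity), rpow_two, ← mul_pow, ← mul_rpow hn.le (by positivity),
          mul_div_cancel₀ _ hn.ne', ellpNorm]

namespace expEllpNormMeasure

variable {n : ℕ} {p : ℝ}

theorem integrable_apply_sq (hp : 2 ≤ p) (i : Fin n) :
    Integrable (fun x : EuclideanSpace ℝ (Fin n) => x i ^ 2) (expEllpNormMeasure n p) :=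
  (measurePreserving_apply (by linarith) i).integrable_comp_of_integrable (g := fun t => t ^ 2)
    (expPowerMeasure.integrable_sq hp)

theorem integrable_norm_sq (hp : 2 ≤ p) :
    Integrable (fun x : EuclideanSpace ℝ (Fin n) => ‖x‖ ^ 2) (expEllpNormMeasure n p) := by
  simp only [EuclideanSpace.real_norm_sq_eq]
  exact integrable_finsetSum _ fun i _ => integrable_apply_sq hp i

theorem integral_norm_sq (hp : 2 ≤ p) :
    ∫ x, ‖x‖ ^ 2 ∂expEllpNormMeasure n p = n * ∫ t, t ^ 2 ∂expPowerMeasure p := by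
  have hcoord (i : Fin n) :
      ∫ x : EuclideanSpace ℝ (Fin n), x i ^ 2 ∂expEllpNormMeasure n p =
        ∫ t, t ^ 2 ∂expPowerMeasure p := by
    have hmp := measurePreserving_apply (n := n) (p := p) (by linarith) i
    rw [← hmp.map_eq, integral_map hmp.aemeasurable (by fun_prop)]
  simp only [EuclideanSpace.real_norm_sq_eq]
  rw [integral_finsetSum _ fun i _ => integrable_apply_sq hp i]
  simp [hcoord]

theorem ofReal_exp_le_lintegral_exp_mul_ellpNorm_sq [NeZero n] (hp : 2 ≤ p) {a : ℝ} (ha : 0 ≤ a) :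
    ENNReal.ofReal (exp (a * (((n : ℝ) ^ (1 / p)) ^ 2 / (8 * exp 1 ^ 2)))) ≤
      ∫⁻ x, ENNReal.ofReal (exp (a * ellpNorm p x ^ 2)) ∂expEllpNormMeasure n p := by
  have := isProbabilityMeasure (n := n) (p := p) (by linarith)
  have hn : (n : ℝ) ≠ 0 := NeZero.ne _
  set R : ℝ := ((n : ℝ) ^ (1 / p)) ^ 2
  have hint : Integrable (fun x => a * (R * (‖x‖ ^ 2 / n))) (expEllpNormMeasure n p) :=
    (((integrable_norm_sq hp).div_const _).const_mul R).const_mul a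
  calc ENNReal.ofReal (exp (a * (R / (8 * exp 1 ^ 2))))
      ≤ ENNReal.ofReal (exp (∫ x, a * (R * (‖x‖ ^ 2 / n)) ∂expEllpNormMeasure n p)) := by
        rw [integral_const_mul, integral_const_mul, integral_div, integral_norm_sq hp,
          mul_div_cancel_left₀ _ hn, div_eq_mul_one_div]
        gcongr
        exact expPowerMeasure.le_integral_sq hp
    _ ≤ ∫⁻ x, ENNReal.ofReal (exp (a * (R * (‖x‖ ^ 2 / n)))) ∂expEllpNormMeasure n p :=
        ofReal_exp_integral_le_lintegral hint
    _ ≤ ∫⁻ x, ENNReal.ofReal (exp (a * ellpNorm p x ^ 2)) ∂expEllpNormMeasure n p := by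
        gcongr with x
        exact sq_mul_norm_sq_div_le_ellpNorm_sq hp x

theorem lintegral_eq_lintegral_coneMeasure [NeZero n] (hp : 1 ≤ p)
    {F : EuclideanSpace ℝ (Fin n) → ℝ≥0∞} (hF : Measurable F) :
    ∫⁻ x, F x ∂expEllpNormMeasure n p =
      ∫⁻ y : lpSphere n p,
        ∫⁻ x : EuclideanSpace ℝ (Fin n), F (ellpNorm p x • y) ∂expEllpNormMeasure n p
        ∂coneMeasure n p hp :=
  lintegral_withDensity_comp_ellpNorm hp (w := fun r => ENNReal.ofReal
    (exp (-r ^ p) / ∫ x : EuclideanSpace ℝ (Fin n), exp (-ellpNorm p x ^ p))) (by fun_prop) hF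

end expEllpNormMeasure

theorem lintegral_exp_sq_inner_coneMeasure_le {n : ℕ} [NeZero n] {p : ℝ} (hp : 2 ≤ p) {b : ℝ}
    (hb : 0 ≤ b) (θ : EuclideanSpace ℝ (Fin n)) :
    ∫⁻ y : lpSphere n p, ENNReal.ofReal (exp (b / (8 * exp 1 ^ 2) *
        ((n : ℝ) ^ (1 / p) * inner ℝ (y : EuclideanSpace ℝ (Fin n)) θ) ^ 2))
        ∂coneMeasure n p (one_le_two.trans hp) ≤
      ∫⁻ x, ENNReal.ofReal (exp (b * inner ℝ x θ ^ 2)) ∂expEllpNormMeasure n p := by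
  rw [expEllpNormMeasure.lintegral_eq_lintegral_coneMeasure (one_le_two.trans hp) (by fun_prop)]
  refine lintegral_mono fun y => ?_
  set z := inner ℝ (y : EuclideanSpace ℝ (Fin n)) θ with hz
  calc ENNReal.ofReal (exp (b / (8 * exp 1 ^ 2) * ((n : ℝ) ^ (1 / p) * z) ^ 2))
      = ENNReal.ofReal (exp (b * z ^ 2 * (((n : ℝ) ^ (1 / p)) ^ 2 / (8 * exp 1 ^ 2)))) := by
        ring_nf
    _ ≤ ∫⁻ x, ENNReal.ofReal (exp (b * z ^ 2 * ellpNorm p x ^ 2)) ∂expEllpNormMeasure n p :=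
        expEllpNormMeasure.ofReal_exp_le_lintegral_exp_mul_ellpNorm_sq hp (by positivity)
    _ = ∫⁻ x : EuclideanSpace ℝ (Fin n), ENNReal.ofReal (exp (b *
          inner ℝ (ellpNorm p x • (y : EuclideanSpace ℝ (Fin n))) θ ^ 2))
          ∂expEllpNormMeasure n p := by
        simp only [real_inner_smul_left, ← hz, mul_pow, mul_assoc, mul_comm (z ^ 2)]

theorem neZero_of_norm_eq_one {n : ℕ} {θ : EuclideanSpace ℝ (Fin n)} (hθ : ‖θ‖ = 1) :
    NeZero n :=
  ⟨by rintro rfl; simp [Subsingleton.elim θ 0] at hθ⟩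

/-- The absolute constant of the theorem. It is the number `l` with `1 / l² = s / (8 * exp 1 ^ 2)`
for `s = 3 / (8 * varianceProxy)`, where `s` is chosen so that `𝔼 exp (s X²) ≤ 2` for every
sub-Gaussian `X` with that variance proxy. -/
noncomputable def psiTwoBound : ℝ :=
  √(64 / 3 * exp 1 ^ 2 * expPowerMeasure.varianceProxy)

theorem psiTwoBound_pos : 0 < psiTwoBound :=
  have := expPowerMeasure.varianceProxy_pos
  sqrt_pos.2 (by positivity)

theorem lintegral_exp_sq_inner_coneMeasure_le_two {n : ℕ} {p : ℝ} (hp : 2 ≤ p)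
    {θ : EuclideanSpace ℝ (Fin n)} (hθ : ‖θ‖ = 1) :
    ∫⁻ y : lpSphere n p, ENNReal.ofReal (exp
        (((n : ℝ) ^ (1 / p) * inner ℝ (y : EuclideanSpace ℝ (Fin n)) θ / psiTwoBound) ^ 2))
        ∂coneMeasure n p (one_le_two.trans hp) ≤ 2 := by
  have : NeZero n := neZero_of_norm_eq_one hθ
  have := expEllpNormMeasure.isProbabilityMeasure (n := n) (p := p) (by linarith)
  have hc : (0 : ℝ) < expPowerMeasure.varianceProxy := expPowerMeasure.varianceProxy_pos
  set c := expPowerMeasure.varianceProxy with hc_def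
  have hsc : 2 * (3 / (8 * (c : ℝ)) * c) = 3 / 4 := by field_simp; norm_num
  have hscale (z : ℝ) : (z / psiTwoBound) ^ 2 = 3 / (8 * c) / (8 * exp 1 ^ 2) * z ^ 2 := by
    rw [div_pow, psiTwoBound, ← hc_def, sq_sqrt (by positivity)]
    field_simp
    norm_num
  simp only [hscale]
  calc _ ≤ ∫⁻ x, ENNReal.ofReal (exp (3 / (8 * c) * inner ℝ x θ ^ 2)) ∂expEllpNormMeasure n p :=
        lintegral_exp_sq_inner_coneMeasure_le hp (by positivity) θ
    _ ≤ ENNReal.ofReal (√(1 - 2 * (3 / (8 * c) * c)))⁻¹ :=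
        lintegral_exp_mul_sq_le_of_hasSubgaussianMGF
          (expEllpNormMeasure.hasSubgaussianMGF_inner hp hθ) (by positivity) (by linarith)
    _ = 2 := by
        rw [hsc, show (1 : ℝ) - 3 / 4 = (2⁻¹) ^ 2 by norm_num, sqrt_sq (by norm_num), inv_inv,
          ENNReal.ofReal_ofNat]

section Orlicz

variable {Ω : Type*} [MeasurableSpace Ω] {P : Measure Ω} {f : Ω → ℝ} {l : ℝ}

theorem memOrlicz_of_lintegral_le_one {M : ℝ → ℝ} (hf : AEMeasurable f P) (hl : 0 < l)
    (h : ∫⁻ x, ENNReal.ofReal (M (|f x| / l)) ∂P ≤ 1) : MemOrlicz M f P :=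
  ⟨hf, l, hl, h.trans_lt ENNReal.one_lt_top⟩

theorem luxemburgNorm_le_of_lintegral_le_one {M : ℝ → ℝ} (hl : 0 < l)
    (h : ∫⁻ x, ENNReal.ofReal (M (|f x| / l)) ∂P ≤ 1) :
    luxemburgNorm M f P ≤ ENNReal.ofReal l :=
  sInf_le ⟨l, hl, h, rfl⟩

theorem lintegral_psiTwo_le_one [IsProbabilityMeasure P]
    (h : ∫⁻ x, ENNReal.ofReal (exp ((f x / l) ^ 2)) ∂P ≤ 2) :
    ∫⁻ x, ENNReal.ofReal (psiTwo (|f x| / l)) ∂P ≤ 1 :=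
  calc ∫⁻ x, ENNReal.ofReal (psiTwo (|f x| / l)) ∂P
      = ∫⁻ x, (ENNReal.ofReal (exp ((f x / l) ^ 2)) - 1) ∂P := by
        simp only [psiTwo, div_pow, sq_abs, ENNReal.ofReal_sub _ zero_le_one, ENNReal.ofReal_one]
    _ = ∫⁻ x, ENNReal.ofReal (exp ((f x / l) ^ 2)) ∂P - 1 := by
        rw [lintegral_sub measurable_const (by simp) (ae_of_all _ fun x => ?_), lintegral_one,
          measure_univ]
        exact ENNReal.one_le_ofReal.2 (one_le_exp (sq_nonneg _))
    _ ≤ 1 := tsub_le_iff_right.2 (by rwa [one_add_one_eq_two])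

end Orlicz

theorem mainTheorem4 :
    ∃ c : ℝ, 0 < c ∧ ∀ (p : ℝ) (hp : 2 ≤ p) (n : ℕ) (θ : EuclideanSpace ℝ (Fin n)),
      θ ∈ Metric.sphere (0 : EuclideanSpace ℝ (Fin n)) 1 →
      MemOrlicz psiTwo (fun x : lpSphere n p => (n : ℝ) ^ (1 / p) * inner ℝ (x : EuclideanSpace ℝ (Fin n)) θ)
          (coneMeasure n p (one_le_two.trans hp)) ∧
        luxemburgNorm psiTwo
          (fun x : lpSphere n p => (n : ℝ) ^ (1 / p) * inner ℝ (x : EuclideanSpace ℝ (Fin n)) θ)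
          (coneMeasure n p (one_le_two.trans hp)) ≤ ENNReal.ofReal c := by
  refine ⟨psiTwoBound, psiTwoBound_pos, fun p hp n θ hθ => ?_⟩
  have hθ₁ : ‖θ‖ = 1 := mem_sphere_zero_iff_norm.1 hθ
  have : NeZero n := neZero_of_norm_eq_one hθ₁
  have := isProbabilityMeasure_coneMeasure (n := n) (one_le_two.trans hp)
  have hle := lintegral_psiTwo_le_one (lintegral_exp_sq_inner_coneMeasure_le_two hp hθ₁)
  exact ⟨memOrlicz_of_lintegral_le_one (by fun_prop) psiTwoBound_pos hle,
    luxemburgNorm_le_of_lintegral_le_one psiTwoBound_pos hle⟩
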